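/- Let $\alpha \in \mathbb{R}$ with $\alpha/2\pi$ irrational, let $X = \mathbb{R}/2\pi\mathbb{Z}$ and $T x = x + \alpha$, and let $C(X) \rtimes_r \mathbb{Z}$ be the reduced crossed product, generated by $C(X)$ and a canonical unitary $\lambda_1$ with $\lambda_1 f \lambda_1^* = f \circ T$. Let $C^*_r(\mathbb{Z})$ be the $C^*$-subalgebra generated by $\lambda_1$, identified with $C(S^1)$, $S^1=\mathbb{R}/2\pi\mathbb{Z}$, so that $\lambda_1$ corresponds to $e^{it}$. A closed ideal $I$ of $C^*_r(\mathbb{Z})$ then corresponds to a closed set $Z(I) \subseteq S^1$, the set of common zeros of the functions in $I$. Let $\tau(t) = t + \alpha$ on $S^1$. Let $\mathfrak{A}$ be the set of $C^*$-algebras $\mathcal{A}$ with $C^*_r(\mathbb{Z}) \subseteq \mathcal{A} \subseteq C(X) \rtimes_r \mathbb{Z}$, ordered by inclusion; it is a lattice with $\mathcal{A}_1 \wedge \mathcal{A}_2 = \mathcal{A}_1 \cap \mathcal{A}_2$ and $\mathcal{A}_1 \vee \mathcal{A}_2$ the $C^*$-algebra generated by $\mathcal{A}_1 \cup \mathcal{A}_2$.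 Let $\mathfrak{D}$ be the set of ideal functions, i.e. functions $\mathfrak{c}$ from $\mathbb{Z}$ to the closed ideals of $C^*_r(\mathbb{Z})$ with $\mathfrak{c}(0) = C^*_r(\mathbb{Z})$, ordered by pointwise inclusion; it is a lattice with $(\mathfrak{c}_1 \wedge \mathfrak{c}_2)(n) = \mathfrak{c}_1(n) \cap \mathfrak{c}_2(n)$ and $(\mathfrak{c}_1 \overline{\vee} \mathfrak{c}_2)(n) = \overline{\mathfrak{c}_1(n) + \mathfrak{c}_2(n)}$. Put $\operatorname{Supp}(\mathfrak{c}) = \{n : \mathfrak{c}(n) \neq (0)\}$. An ideal function $\mathfrak{c}$ is called closed if - (Cif1) $Z(\mathfrak{c}(-n)) = \tau^{n} Z(\mathfrak{c}(n))$ for all $n \in \mathbb{Z}$, and - (Cif2) $Z(\mathfrak{c}(m+n)) \subseteq \tau^{-m} Z(\mathfrak{c}(n)) \cup Z(\mathfrak{c}(m))$ for all $m, n \in \operatorname{Supp}(\mathfrak{c})$. Let $\mathfrak{C} \subseteq \mathfrak{D}$ be the set of closed ideal functions, with the induced order. For $\mathfrak{c} \in \mathfrak{D}$ let $\Phi(\mathfrak{c})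 \in \mathfrak{A}$ be the $C^*$-algebra generated by all $e^{inx}\eta$ with $n \in \mathbb{Z}$, $\eta \in \mathfrak{c}(n)$, and for $\mathcal{A} \in \mathfrak{A}$ let $\Psi(\mathcal{A}) \in \mathfrak{D}$ be $\Psi(\mathcal{A})(n) = \{\eta \in C^*_r(\mathbb{Z}) : e^{inx}\eta \in \mathcal{A}\}$. Then: 1. $\Phi$ and $\Psi$ form a monotone Galois connection: for $\mathfrak{c} \in \mathfrak{D}$ and $\mathcal{A} \in \mathfrak{A}$, $\Phi(\mathfrak{c}) \subseteq \mathcal{A}$ if and only if $\mathfrak{c} \le \Psi(\mathcal{A})$. 2. $\mathcal{A} = \Phi(\Psi(\mathcal{A}))$ for every $\mathcal{A} \in \mathfrak{A}$. 3. For $\mathfrak{c} \in \mathfrak{D}$, $\mathfrak{c} = \Psi(\Phi(\mathfrak{c}))$ if and only if $\mathfrak{c}$ is closed. 4. $\mathfrak{C}$ is a lattice, in which the meet of $\mathfrak{c}_1, \mathfrak{c}_2$ is $\mathfrak{c}_1 \wedge \mathfrak{c}_2$ and the join is $\Psi(\Phi(\mathfrak{c}_1 \overline{\vee} \mathfrak{c}_2))$,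 and $\Phi|_{\mathfrak{C}} : \mathfrak{C} \to \mathfrak{A}$ is an isomorphism of lattices with inverse $\Psi$. -/

import Mathlib

namespace RotationAlgebra

open MeasureTheory

instance factTwoPiPos : Fact (0 < 2 * Real.pi) := ⟨Real.two_pi_pos⟩

/-! ### The reduced crossed product of the rotation -/

/-- The phase space `X = ℝ / 2πℤ`. -/
abbrev X : Type := AddCircle (2 * Real.pi)

/-- Counting measure on `ℤ` times normalized Lebesgue measure on `X`. -/
noncomputable abbrev regMeasure : Measure (ℤ × X) :=
  Measure.count.prod AddCircle.haarAddCircle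

/-- The Hilbert space `ℓ²(ℤ, L²(X)) = L²(ℤ × X)` of the regular representation. -/
noncomputable abbrev H : Type := Lp ℂ 2 regMeasure

/-- The C*-algebra of bounded operators on `H`. -/
noncomputable abbrev B : Type := H →L[ℂ] H

theorem measurePreserving_shift (m : ℤ) :
    MeasurePreserving (fun p : ℤ × X => (p.1 - m, p.2)) regMeasure regMeasure :=
  (measurePreserving_sub_right Measure.count m).prod (MeasurePreserving.id _)

/-- The canonical unitaries `λ_m` of the crossed product: `(λ_m ξ)(k, x) = ξ(k - m, x)`. -/
noncomputable def lam (m : ℤ) : B :=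
  (Lp.compMeasurePreservingₗᵢ ℂ _ (measurePreserving_shift m)).toContinuousLinearMap

theorem lam_ae (m : ℤ) (ξ : H) :
    (lam m ξ : ℤ × X → ℂ) =ᵐ[regMeasure] fun p => ξ (p.1 - m, p.2) :=
  Lp.coeFn_compMeasurePreserving ξ (measurePreserving_shift m)

/-- The function `(k, x) ↦ f (T⁻ᵏ x) = f (x - kα)`, where `T x = x + α`. -/
noncomputable def orbitFun (α : ℝ) (f : C(X, ℂ)) : ℤ × X → ℂ :=
  fun p => f (p.2 - p.1 • (α : X))

theorem memLp_orbitFun (α : ℝ) (f : C(X, ℂ)) : MemLp (orbitFun α f) ⊤ regMeasure := by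
  refine memLp_top_of_bound (Continuous.aestronglyMeasurable ?_) ‖f‖
    (Filter.Eventually.of_forall fun p => f.norm_coe_le_norm _)
  unfold orbitFun
  fun_prop

/-- The copy of `C(X)` in the regular representation: `(f ξ)(k, x) = f (T⁻ᵏ x) ξ(k, x)`, so that
`λ₁ f λ₁* = f ∘ T` with `T x = x + α`. -/
noncomputable def mulOp (α : ℝ) (f : C(X, ℂ)) : B :=
  (ContinuousLinearMap.mul ℂ ℂ).holderL regMeasure ⊤ 2 2 ((memLp_orbitFun α f).toLp _)

theorem mulOp_ae (α : ℝ) (f : C(X, ℂ)) (ξ : H) :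
    (mulOp α f ξ : ℤ × X → ℂ) =ᵐ[regMeasure] fun p => orbitFun α f p * ξ p := by
  have h1 := (ContinuousLinearMap.mul ℂ ℂ).coeFn_holder (r := 2)
    ((memLp_orbitFun α f).toLp _) ξ
  have h2 := (memLp_orbitFun α f).coeFn_toLp
  filter_upwards [h1, h2] with p hp1 hp2
  rw [← hp2]
  exact hp1

/-- `C*_r(ℤ)`, as the C*-subalgebra generated by `λ₁`. -/
noncomputable abbrev cstarZ : StarSubalgebra ℂ B := StarAlgebra.elemental ℂ (lam 1)

/-- The reduced crossed product `C(X) ⋊_r ℤ` of the rotation by `α`: the C*-algebra generated by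
`C(X)` and the canonical unitary `λ₁` in the regular representation. -/
noncomputable def crossedProduct (α : ℝ) : StarSubalgebra ℂ B :=
  (StarAlgebra.adjoin ℂ (insert (lam 1) (Set.range (mulOp α)))).topologicalClosure

/-- The element `e^{inx}` of `C(X)`, inside the crossed product. -/
noncomputable def expOp (α : ℝ) (n : ℤ) : B := mulOp α (fourier n)

theorem expOp_zero (α : ℝ) : expOp α 0 = 1 := by
  ext1 ξ
  refine Lp.ext ?_
  filter_upwards [mulOp_ae α (fourier 0) ξ] with p hp
  rw [expOp, hp]
  simp [orbitFun]

theorem lam_comp_lam_neg (m : ℤ) : lam m * lam (-m) = 1 := by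
  ext1 ξ
  refine Lp.ext ?_
  have h := (measurePreserving_shift m).quasiMeasurePreserving.ae (lam_ae (-m) ξ)
  filter_upwards [lam_ae m (lam (-m) ξ), h] with p hp hp'
  rw [mul_apply_eq_comp, hp, hp']
  simp

theorem star_lam_mul_lam (m : ℤ) : star (lam m) * lam m = 1 :=
  (lam m).norm_map_iff_adjoint_comp_self.mp
    (Lp.compMeasurePreservingₗᵢ ℂ _ (measurePreserving_shift m)).norm_map

theorem lam_mem_unitary (m : ℤ) : lam m ∈ unitary B := by
  have h : star (lam m) = lam (-m) := by
    calc star (lam m) = star (lam m) * (lam m * lam (-m)) := by rw [lam_comp_lam_neg, mul_one]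
      _ = lam (-m) := by rw [← mul_assoc, star_lam_mul_lam, one_mul]
  exact Unitary.mem_iff.mpr ⟨star_lam_mul_lam m, by rw [h, lam_comp_lam_neg]⟩

instance lamStarNormal : IsStarNormal (lam 1) :=
  ⟨by
    obtain ⟨h1, h2⟩ := Unitary.mem_iff.mp (lam_mem_unitary 1)
    exact h1.trans h2.symm⟩

/-! ### Ideal functions and intermediate algebras -/

noncomputable instance : CommRing cstarZ := inferInstance

noncomputable instance : NonUnitalNonAssocSemiring cstarZ := inferInstance

instance : ContinuousAdd cstarZ :=
  inferInstanceAs (ContinuousAdd (StarAlgebra.elemental ℂ (lam 1)).toSubalgebra)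

instance : ContinuousConstSMul cstarZ cstarZ :=
  ⟨fun a => (continuous_const (y := a)).mul continuous_id⟩

/-- The closed ideals of `C*_r(ℤ)`, ordered by inclusion. The algebra is commutative, so an ideal
is the same thing as a submodule of the regular module, and it is automatically two-sided.
Meet is intersection, join is the closure of the sum. -/
abbrev ClosedIdeal : Type := ClosedSubmodule cstarZ cstarZ

noncomputable instance : Lattice ClosedIdeal := inferInstance

/-- Ideal functions `𝔠 : ℤ → {closed ideals of C*_r(ℤ)}` with `𝔠(0) = C*_r(ℤ)`, with the pointwise
order. -/
abbrev IdealFunction : Type := {c : ℤ → ClosedIdeal // c 0 = ⊤}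

/-- The lattice of ideal functions, with pointwise operations. -/
noncomputable instance : Lattice IdealFunction :=
  Subtype.lattice
    (fun c₁ c₂ h₁ h₂ => by
      change c₁ 0 ⊔ c₂ 0 = ⊤
      rw [h₁, h₂, sup_idem])
    (fun c₁ c₂ h₁ h₂ => by
      change c₁ 0 ⊓ c₂ 0 = ⊤
      rw [h₁, h₂, inf_idem])

/-- Intermediate C*-algebras `C*_r(ℤ) ⊆ 𝒜 ⊆ C(X) ⋊_r ℤ`, ordered by inclusion. -/
abbrev IntermediateAlgebra (α : ℝ) : Type :=
  {A : StarSubalgebra ℂ B // cstarZ ≤ A ∧ A ≤ crossedProduct α ∧ IsClosed (A : Set B)}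

/-- The lattice of intermediate algebras: meet is intersection, join is the closure of the
*-algebra generated by the two algebras. -/
noncomputable instance (α : ℝ) : Lattice (IntermediateAlgebra α) where
  inf A₁ A₂ := ⟨A₁.1 ⊓ A₂.1, le_inf A₁.2.1 A₂.2.1, inf_le_left.trans A₁.2.2.1,
    A₁.2.2.2.inter A₂.2.2.2⟩
  inf_le_left _ _ := inf_le_left (α := StarSubalgebra ℂ B)
  inf_le_right _ _ := inf_le_right (α := StarSubalgebra ℂ B)
  le_inf _ _ _ := le_inf (α := StarSubalgebra ℂ B)
  sup A₁ A₂ := ⟨(A₁.1 ⊔ A₂.1).topologicalClosure,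
    A₁.2.1.trans (le_sup_left.trans (StarSubalgebra.le_topologicalClosure _)),
    StarSubalgebra.topologicalClosure_minimal (sup_le A₁.2.2.1 A₂.2.2.1)
      (StarSubalgebra.isClosed_topologicalClosure _),
    StarSubalgebra.isClosed_topologicalClosure _⟩
  le_sup_left A₁ A₂ := (le_sup_left (α := StarSubalgebra ℂ B)).trans
    (StarSubalgebra.le_topologicalClosure (A₁.1 ⊔ A₂.1))
  le_sup_right A₁ A₂ := (le_sup_right (α := StarSubalgebra ℂ B)).trans
    (StarSubalgebra.le_topologicalClosure (A₁.1 ⊔ A₂.1))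
  sup_le _ _ A₃ h₁ h₂ := StarSubalgebra.topologicalClosure_minimal
    (sup_le (α := StarSubalgebra ℂ B) h₁ h₂) A₃.2.2.2

theorem cstarZ_le_crossedProduct (α : ℝ) : cstarZ ≤ crossedProduct α :=
  StarAlgebra.elemental.le_of_mem (StarSubalgebra.isClosed_topologicalClosure _)
    (StarSubalgebra.le_topologicalClosure _
      (StarAlgebra.subset_adjoin ℂ _ (Set.mem_insert _ _)))

theorem expOp_mem_crossedProduct (α : ℝ) (n : ℤ) : expOp α n ∈ crossedProduct α :=
  StarSubalgebra.le_topologicalClosure _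
    (StarAlgebra.subset_adjoin ℂ _ (Set.mem_insert_of_mem _ (Set.mem_range_self _)))

/-- The elements `e^{inx} η` with `n ∈ ℤ` and `η ∈ 𝔠(n)`. -/
def generators (α : ℝ) (c : IdealFunction) : Set B :=
  {a | ∃ (n : ℤ) (η : cstarZ), η ∈ c.1 n ∧ a = expOp α n * (η : B)}

/-- `Φ(𝔠)` is the C*-algebra generated by the elements `e^{inx} η`, `η ∈ 𝔠(n)`. -/
noncomputable def Phi (α : ℝ) (c : IdealFunction) : IntermediateAlgebra α :=
  ⟨(StarAlgebra.adjoin ℂ (generators α c)).topologicalClosure, by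
    refine ⟨fun a ha => ?_, ?_, StarSubalgebra.isClosed_topologicalClosure _⟩
    · refine StarSubalgebra.le_topologicalClosure _ (StarAlgebra.subset_adjoin ℂ _
        ⟨0, ⟨a, ha⟩, ?_, ?_⟩)
      · rw [c.2]
        exact ClosedSubmodule.mem_top
      · rw [expOp_zero, one_mul]
    · refine StarSubalgebra.topologicalClosure_minimal (StarAlgebra.adjoin_le ?_)
        (StarSubalgebra.isClosed_topologicalClosure _)
      rintro _ ⟨n, η, -, rfl⟩
      exact mul_mem (expOp_mem_crossedProduct α n) (cstarZ_le_crossedProduct α η.2)⟩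

/-- `Ψ(𝒜)(n) = {η ∈ C*_r(ℤ) | e^{inx} η ∈ 𝒜}`. -/
noncomputable def Psi (α : ℝ) (A : IntermediateAlgebra α) : IdealFunction :=
  ⟨fun n =>
    { carrier := {η : cstarZ | expOp α n * (η : B) ∈ A.1}
      add_mem' := fun {η ζ} hη hζ => by
        change expOp α n * ((η : B) + (ζ : B)) ∈ A.1
        rw [mul_add]
        exact add_mem hη hζ
      zero_mem' := by
        change expOp α n * (0 : B) ∈ A.1
        rw [mul_zero]
        exact zero_mem _
      smul_mem' := fun ζ η hη => by
        change expOp α n * ((ζ * η : cstarZ) : B) ∈ A.1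
        rw [mul_comm ζ η]
        change expOp α n * ((η : B) * (ζ : B)) ∈ A.1
        rw [← mul_assoc]
        exact mul_mem hη (A.2.1 ζ.2)
      isClosed' := A.2.2.2.preimage (continuous_const.mul continuous_subtype_val) }, by
    refine SetLike.ext fun η => iff_of_true ?_ ClosedSubmodule.mem_top
    change expOp α 0 * (η : B) ∈ A.1
    rw [expOp_zero, one_mul]
    exact A.2.1 η.2⟩

/-! ### Set functions and closed ideal functions -/

/-- The inclusion of the spectrum of `λ₁` in the circle `S¹`. -/
noncomputable def spectrumToCircle : C(spectrum ℂ (lam 1), Circle) where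
  toFun z := ⟨z.1, spectrum.subset_circle_of_unitary (lam_mem_unitary 1) z.2⟩
  continuous_toFun := continuous_subtype_val.subtype_mk _

/-- The identification `C(S¹) → C*_r(ℤ)`, `φ ↦ φ̂ = φ(λ₁)`: the *-homomorphism that sends the
coordinate function `e^{it}` to `λ₁`. -/
noncomputable def hat : C(Circle, ℂ) →⋆ₐ[ℂ] cstarZ :=
  (continuousFunctionalCalculus (lam 1) : C(spectrum ℂ (lam 1), ℂ) →⋆ₐ[ℂ] cstarZ).comp
    (spectrumToCircle.compStarAlgHom' ℂ ℂ)

/-- The closed subset of `S¹` that corresponds to an ideal `I` of `C*_r(ℤ) ≅ C(S¹)`: the common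
zeros of the functions in `I`. -/
def zeroSet (I : ClosedIdeal) : Set Circle :=
  {z | ∀ φ : C(Circle, ℂ), hat φ ∈ I → φ z = 0}

/-- The rotation `τ t = t + α` of `S¹`. -/
noncomputable def tau (α : ℝ) : Circle ≃ₜ Circle := Homeomorph.mulLeft (Circle.exp α)

/-- The support of an ideal function. -/
def supp (c : IdealFunction) : Set ℤ := {n | c.1 n ≠ ⊥}

/-- The conditions `Cif1` and `Cif2` that define closed ideal functions. -/
structure IsClosedIdealFunction (α : ℝ) (c : IdealFunction) : Prop where
  cif1 : ∀ n : ℤ, zeroSet (c.1 (-n)) = (tau α ^ n) '' zeroSet (c.1 n)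
  cif2 : ∀ m ∈ supp c, ∀ n ∈ supp c,
    zeroSet (c.1 (m + n)) ⊆ (tau α ^ (-m)) '' zeroSet (c.1 n) ∪ zeroSet (c.1 m)

/-- The closed ideal functions, with the order of ideal functions. -/
abbrev ClosedIdealFunction (α : ℝ) : Type := {c : IdealFunction // IsClosedIdealFunction α c}

end RotationAlgebra

/-! Conjugation by `λ₁` multiplies `e^{inx} η` by `wⁿ`, where `w = e^{iα}`. Irrationality makes the
powers `wⁿ` distinct, so the spaces `e^{inx} C*_r(ℤ)` are eigenspaces with distinct eigenvalues, and
their closed span is the whole crossed product. Twisted ergodic means of the conjugation extract the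
spectral components of an element, and Fejér sums rebuild the element from them
(`exists_tendsto_ergodicMean`, `tendsto_fejerSum_of_mem_closure`).

An intermediate algebra contains `λ₁`, so it is invariant under the conjugation and contains the
components of its elements. It is therefore the closed span of its elements `e^{inx} η`, which gives
`Phi_Psi`. Cif1 and Cif2 say, through zero sets, that the sum of the spaces `e^{inx} 𝔠(n)` is closed
under adjoints and products. For closed `𝔠` that sum is thus dense in `Φ(𝔠)`, and an eigenvector in
`Φ(𝔠)` lies in the matching summand, which gives `Psi_Phi`. The lattice statements then follow
formally from the Galois connection. -/

namespace RotationAlgebra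

open MeasureTheory Filter Topology

/-! ### Twisted ergodic means of a contraction. -/

section ErgodicMeans

variable {E : Type*} [NormedAddCommGroup E] [NormedSpace ℂ E]

/-- The twisted ergodic means `M⁻¹ ∑_{j < M} zʲ Vʲ`. -/
noncomputable def ergodicMean (V : E →L[ℂ] E) (z : ℂ) (M : ℕ) : E →L[ℂ] E :=
  (M : ℂ)⁻¹ • ∑ j ∈ Finset.range M, z ^ j • V ^ j

theorem ergodicMean_apply (V : E →L[ℂ] E) (z : ℂ) (M : ℕ) (a : E) :
    ergodicMean V z M a = (M : ℂ)⁻¹ • ∑ j ∈ Finset.range M, z ^ j • (V ^ j) a := by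
  simp [ergodicMean]

theorem norm_pow_apply_le {V : E →L[ℂ] E} (hV : ∀ a, ‖V a‖ ≤ ‖a‖) (j : ℕ) (a : E) :
    ‖(V ^ j) a‖ ≤ ‖a‖ := by
  induction j with
  | zero => simp
  | succ j ih =>
    rw [pow_succ']
    exact (hV _).trans ih

theorem norm_ergodicMean_apply_le {V : E →L[ℂ] E} (hV : ∀ a, ‖V a‖ ≤ ‖a‖) {z : ℂ}
    (hz : ‖z‖ = 1) (M : ℕ) (a : E) : ‖ergodicMean V z M a‖ ≤ ‖a‖ := by
  rw [ergodicMean_apply, norm_smul, norm_inv, Complex.norm_natCast]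
  have h : ‖∑ j ∈ Finset.range M, z ^ j • (V ^ j) a‖ ≤ M * ‖a‖ := by
    refine (norm_sum_le_of_le (f := fun j => z ^ j • (V ^ j) a) (n := fun _ => ‖a‖) _
      fun j _ => ?_).trans (by simp)
    rw [norm_smul, norm_pow, hz, one_pow, one_mul]
    exact norm_pow_apply_le hV j a
  rcases Nat.eq_zero_or_pos M with rfl | hM
  · simp
  · have : (0 : ℝ) < M := by exact_mod_cast hM
    rw [inv_mul_le_iff₀ this]
    exact h

theorem pow_apply_of_eigenvector {V : E →L[ℂ] E} {u : ℂ} {a : E} (ha : V a = u • a) (j : ℕ) :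
    (V ^ j) a = u ^ j • a := by
  induction j with
  | zero => simp
  | succ j ih =>
    rw [pow_succ', mul_apply_eq_comp, ih, map_smul, ha, smul_smul, pow_succ]

theorem ergodicMean_apply_of_eigenvector {V : E →L[ℂ] E} {u : ℂ} {a : E} (ha : V a = u • a)
    (z : ℂ) (M : ℕ) :
    ergodicMean V z M a = ((M : ℂ)⁻¹ * ∑ j ∈ Finset.range M, (z * u) ^ j) • a := by
  rw [ergodicMean_apply, mul_smul, Finset.sum_smul]
  simp_rw [pow_apply_of_eigenvector ha, smul_smul, mul_pow]

theorem tendsto_ergodicMean_of_mul_eq_one {V : E →L[ℂ] E} {u z : ℂ} {a : E} (ha : V a = u • a)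
    (hz : z * u = 1) : Tendsto (fun M => ergodicMean V z M a) atTop (𝓝 a) := by
  refine tendsto_const_nhds.congr' ?_
  filter_upwards [eventually_gt_atTop 0] with M hM
  rw [ergodicMean_apply_of_eigenvector ha, hz]
  have : (M : ℂ) ≠ 0 := by exact_mod_cast hM.ne'
  simp [this]

/-- The geometric sum of powers of `z * u` is bounded by `2 / ‖z * u - 1‖`, so its mean is `O(1 /
M)`. -/
theorem tendsto_ergodicMean_of_mul_ne_one {V : E →L[ℂ] E} {u z : ℂ} {a : E} (ha : V a = u • a)
    (hn : ‖z * u‖ = 1) (hz : z * u ≠ 1) :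
    Tendsto (fun M => ergodicMean V z M a) atTop (𝓝 0) := by
  simp_rw [ergodicMean_apply_of_eigenvector ha]
  rw [← zero_smul ℂ a]
  refine Tendsto.smul_const ?_ a
  have hsub : z * u - 1 ≠ 0 := sub_ne_zero.mpr hz
  refine squeeze_zero_norm (a := fun M : ℕ => (M : ℝ)⁻¹ * (2 / ‖z * u - 1‖)) (fun M => ?_) ?_
  · rw [geom_sum_eq hz, norm_mul, norm_inv, Complex.norm_natCast, norm_div]
    gcongr
    calc ‖(z * u) ^ M - 1‖ ≤ ‖(z * u) ^ M‖ + ‖(1 : ℂ)‖ := norm_sub_le _ _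
      _ = 2 := by rw [norm_pow, hn]; norm_num
  · simpa using (tendsto_inv_atTop_nhds_zero_nat (𝕜 := ℝ)).mul_const (2 / ‖z * u - 1‖)

/-- The vectors along which a sequence of operators converges to an element of `K`. -/
def convergenceSubmodule (S : ℕ → E →L[ℂ] E) (K : Submodule ℂ E) : Submodule ℂ E where
  carrier := {a | ∃ b ∈ K, Tendsto (fun M => S M a) atTop (𝓝 b)}
  add_mem' := by
    rintro a a' ⟨b, hb, h⟩ ⟨b', hb', h'⟩
    exact ⟨b + b', add_mem hb hb', by simpa using h.add h'⟩
  zero_mem' := ⟨0, zero_mem _, by simp⟩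
  smul_mem' := by
    rintro c a ⟨b, hb, h⟩
    exact ⟨c • b, K.smul_mem c hb, by simpa using h.const_smul c⟩

/-- The operators are uniformly contractive, so convergence passes to norm limits by an `ε / 3`
argument, and nearby vectors have nearby limits, which keeps the limit in `K`. -/
theorem isClosed_convergenceSubmodule [CompleteSpace E] {S : ℕ → E →L[ℂ] E}
    (hS : ∀ M a, ‖S M a‖ ≤ ‖a‖) {K : Submodule ℂ E} (hK : IsClosed (K : Set E)) :
    IsClosed (convergenceSubmodule S K : Set E) := by
  refine isClosed_of_closure_subset fun a ha => ?_
  rw [Metric.mem_closure_iff] at ha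
  have hc : CauchySeq fun M => S M a := by
    rw [Metric.cauchySeq_iff']
    intro ε hε
    obtain ⟨a', ⟨b, -, hb⟩, hd⟩ := ha (ε / 3) (by positivity)
    obtain ⟨N, hN⟩ := Metric.cauchySeq_iff'.mp hb.cauchySeq (ε / 3) (by positivity)
    refine ⟨N, fun M hM => ?_⟩
    have h1 : ∀ M, dist (S M a) (S M a') < ε / 3 := fun M => by
      rw [dist_eq_norm, ← map_sub]
      exact (hS M _).trans_lt (by rwa [← dist_eq_norm])
    have h2 := dist_triangle4 (S M a) (S M a') (S N a') (S N a)
    have h3 := h1 N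
    rw [dist_comm] at h3
    linarith [h1 M, hN M hM]
  obtain ⟨b, hb⟩ := cauchySeq_tendsto_of_complete hc
  refine ⟨b, ?_, hb⟩
  rw [← SetLike.mem_coe, ← hK.closure_eq, Metric.mem_closure_iff]
  intro ε hε
  obtain ⟨a', ⟨b', hb'K, hb'⟩, hd⟩ := ha (ε / 2) (by positivity)
  refine ⟨b', hb'K, lt_of_le_of_lt ?_ (half_lt_self hε)⟩
  refine le_of_tendsto (hb.dist hb') (Eventually.of_forall fun M => ?_)
  rw [dist_eq_norm, ← map_sub]
  exact (hS M _).trans (by rw [← dist_eq_norm]; exact hd.le)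

/-! ### Fejér summation. -/

/-- The Fejér sums `∑_{|n| < N} (1 - |n| / N) p n`. -/
noncomputable def fejerSum (p : ℤ → E) (N : ℕ) : E :=
  (N : ℂ)⁻¹ • ∑ k ∈ Finset.range N, ∑ l ∈ Finset.range N, p ((k : ℤ) - l)

theorem fejerSum_sub (p q : ℤ → E) (N : ℕ) :
    fejerSum (p - q) N = fejerSum p N - fejerSum q N := by
  simp [fejerSum, smul_sub]

theorem fejerSum_add (p q : ℤ → E) (N : ℕ) :
    fejerSum (p + q) N = fejerSum p N + fejerSum q N := by
  simp [fejerSum, smul_add, Finset.sum_add_distrib]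

theorem fejerSum_smul (c : ℂ) (p : ℤ → E) (N : ℕ) :
    fejerSum (c • p) N = c • fejerSum p N := by
  simp only [fejerSum, Pi.smul_apply, ← Finset.smul_sum]
  rw [smul_comm]

theorem fejerSum_mem {K : Submodule ℂ E} {p : ℤ → E} (hp : ∀ n, p n ∈ K) (N : ℕ) :
    fejerSum p N ∈ K :=
  K.smul_mem _ (sum_mem fun _ _ => sum_mem fun _ _ => hp _)

theorem tendsto_fejerSum {ι : Type*} {l : Filter ι} {P : ι → ℤ → E} {p : ℤ → E}
    (h : ∀ n, Tendsto (fun i => P i n) l (𝓝 (p n))) (N : ℕ) :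
    Tendsto (fun i => fejerSum (P i) N) l (𝓝 (fejerSum p N)) :=
  (tendsto_finsetSum _ fun _ _ => tendsto_finsetSum _ fun _ _ => h _).const_smul _

/-- The scalar counts the pairs `(k, l)` in the square with `k - l = m`. The truncated subtraction
gives the correct value `0` when `N ≤ |m|`. -/
theorem fejerSum_single (m : ℤ) (a : E) (N : ℕ) :
    fejerSum (Pi.single m a) N = ((N : ℂ)⁻¹ * (N - m.natAbs : ℕ)) • a := by
  have h : ∑ k ∈ Finset.range N, ∑ l ∈ Finset.range N, (Pi.single m a : ℤ → E) ((k : ℤ) - l)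
      = ((N - m.natAbs : ℕ) : ℂ) • a := by
    have hcard : ((Finset.range N ×ˢ Finset.range N).filter
        fun x : ℕ × ℕ => (x.1 : ℤ) - x.2 = m).card = N - m.natAbs := by
      rw [← Finset.card_range (N - m.natAbs)]
      -- The diagonal `k - l = m` is parametrized by `i ↦ (i + m⁺, i + m⁻)`.
      refine (Finset.card_bij (fun i _ => (i + m.toNat, i + (-m).toNat)) ?_ ?_ ?_).symm
      · intro i hi
        simp only [Finset.mem_range, Finset.mem_filter, Finset.mem_product] at hi ⊢
        omega
      · intro i _ j _ hij
        simp only [Prod.mk.injEq] at hij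
        omega
      · rintro ⟨k, l⟩ hkl
        simp only [Finset.mem_range, Finset.mem_filter, Finset.mem_product] at hkl
        refine ⟨k - m.toNat, Finset.mem_range.mpr (by omega), ?_⟩
        ext <;> simp only <;> omega
    rw [← Finset.sum_product', ← hcard]
    simp_rw [Pi.single_apply]
    rw [← Finset.sum_filter, Finset.sum_const, Nat.cast_smul_eq_nsmul]
  rw [fejerSum, h, smul_smul]

theorem tendsto_fejerSum_single (m : ℤ) (a : E) :
    Tendsto (fejerSum (Pi.single m a)) atTop (𝓝 a) := by
  have h : Tendsto (fun N : ℕ => ((N : ℂ)⁻¹ * (N - m.natAbs : ℕ))) atTop (𝓝 1) := by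
    have h0 := (tendsto_inv_atTop_nhds_zero_nat (𝕜 := ℂ)).mul_const (m.natAbs : ℂ)
    have h1 : Tendsto (fun N : ℕ => 1 - (N : ℂ)⁻¹ * m.natAbs) atTop (𝓝 1) := by
      simpa using h0.const_sub 1
    refine h1.congr' ?_
    filter_upwards [eventually_gt_atTop 0, eventually_ge_atTop m.natAbs] with N h2 h3
    have : (N : ℂ) ≠ 0 := by exact_mod_cast h2.ne'
    rw [Nat.cast_sub h3]
    field_simp
  have := h.smul_const a
  rw [one_smul] at this
  exact this.congr fun N => (fejerSum_single m a N).symm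

/-- Summing over `n` before `j` collects the phases into the Fejér kernel at the `j`-th orbit point.
What matters is that these weights on `(V ^ j) a` are nonnegative. -/
theorem fejerSum_ergodicMean (V : E →L[ℂ] E) {w : ℂ} (hw : ‖w‖ = 1) (N M : ℕ) (a : E) :
    fejerSum (fun n => ergodicMean V (w ^ (-n)) M a) N = (M : ℂ)⁻¹ • ∑ j ∈ Finset.range M,
      (((N : ℝ)⁻¹ * ‖∑ k ∈ Finset.range N, (w ^ (-(k : ℤ))) ^ j‖ ^ 2 : ℝ) : ℂ) • (V ^ j) a := by
  have hw0 : w ≠ 0 := by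
    rintro rfl
    simp at hw
  have hc : ∀ j : ℕ, (((N : ℝ)⁻¹ * ‖∑ k ∈ Finset.range N, (w ^ (-(k : ℤ))) ^ j‖ ^ 2 : ℝ) : ℂ) =
      (N : ℂ)⁻¹ * ∑ k ∈ Finset.range N, ∑ l ∈ Finset.range N, (w ^ (-((k : ℤ) - l))) ^ j := by
    intro j
    push_cast
    rw [← Complex.mul_conj', map_sum, Finset.sum_mul_sum]
    congr 1
    refine Finset.sum_congr rfl fun k _ => Finset.sum_congr rfl fun l _ => ?_
    rw [map_pow, map_zpow₀, ← Complex.inv_eq_conj hw, ← mul_pow, inv_zpow, zpow_neg, zpow_neg,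
      inv_inv, neg_sub, zpow_sub₀ hw0, zpow_natCast, zpow_natCast, div_eq_mul_inv, mul_comm]
  simp_rw [hc, fejerSum, ergodicMean_apply, ← Finset.smul_sum]
  rw [smul_comm]
  congr 1
  simp_rw [mul_smul, ← Finset.smul_sum, Finset.sum_smul]
  congr 1
  conv_rhs => rw [Finset.sum_comm]
  refine Finset.sum_congr rfl fun k _ => ?_
  rw [Finset.sum_comm]

/-- Positivity of the Fejér weights bounds the sum by their total mass times `‖a‖`. This makes Fejér
summation contractive uniformly in `N`. -/
theorem norm_fejerSum_le {V : E →L[ℂ] E} (hV : ∀ a, ‖V a‖ ≤ ‖a‖) {w : ℂ} (hw : ‖w‖ = 1)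
    (hw' : ∀ n : ℤ, w ^ n = 1 → n = 0) {a : E} {p : ℤ → E}
    (hp : ∀ n, Tendsto (fun M => ergodicMean V (w ^ (-n)) M a) atTop (𝓝 (p n))) (N : ℕ) :
    ‖fejerSum p N‖ ≤ ‖a‖ := by
  -- The total mass of the weights is the same expression for the identity of `ℂ` at the vector `1`.
  -- As `M → ∞` only the component `n = 0` survives.
  have hscalar : Tendsto (fun M => fejerSum
      (fun n => ergodicMean (ContinuousLinearMap.id ℂ ℂ) (w ^ (-n)) M 1) N) atTop
      (𝓝 (fejerSum (Pi.single 0 1) N)) := by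
    refine tendsto_fejerSum (fun n => ?_) N
    have h1 : ContinuousLinearMap.id ℂ ℂ 1 = (1 : ℂ) • 1 := by simp
    by_cases hn : n = 0
    · subst hn
      rw [Pi.single_eq_same]
      exact tendsto_ergodicMean_of_mul_eq_one h1 (by simp)
    · rw [Pi.single_eq_of_ne hn]
      refine tendsto_ergodicMean_of_mul_ne_one h1 (by simp [hw]) fun h => hn ?_
      rw [mul_one] at h
      simpa using hw' _ h
  have hone : ‖fejerSum (Pi.single 0 (1 : ℂ)) N‖ ≤ 1 := by
    rw [fejerSum_single]
    rcases Nat.eq_zero_or_pos N with rfl | hN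
    · simp
    · simp [hN.ne']
  refine (le_of_tendsto_of_tendsto (tendsto_fejerSum hp N).norm (hscalar.norm.mul_const ‖a‖)
    (Eventually.of_forall fun M => ?_)).trans (mul_le_of_le_one_left (norm_nonneg a) hone)
  dsimp only
  rw [fejerSum_ergodicMean V hw, fejerSum_ergodicMean _ hw]
  have hid : ∀ j : ℕ, (ContinuousLinearMap.id ℂ ℂ ^ j) (1 : ℂ) = 1 := fun j => by
    rw [pow_apply_of_eigenvector (u := 1) (by simp)]
    simp
  simp_rw [hid, smul_eq_mul, mul_one, norm_smul, norm_mul, mul_assoc]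
  gcongr
  rw [← Complex.ofReal_sum, Complex.norm_real, Real.norm_of_nonneg
    (Finset.sum_nonneg fun _ _ => by positivity), Finset.sum_mul]
  refine norm_sum_le_of_le _ fun j _ => ?_
  rw [norm_smul, Complex.norm_real, Real.norm_of_nonneg (by positivity)]
  gcongr
  exact norm_pow_apply_le hV j a

/-! ### Spectral decomposition along eigenspaces. -/

section Spectral

variable {V : E →L[ℂ] E} {w : ℂ} {W : ℤ → Submodule ℂ E}

theorem norm_zpow_eq_one (hw : ‖w‖ = 1) (n : ℤ) : ‖w ^ n‖ = 1 := by
  rw [norm_zpow, hw, one_zpow]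

theorem tendsto_ergodicMean_single (hw : ‖w‖ = 1) (hw' : ∀ n : ℤ, w ^ n = 1 → n = 0)
    {m : ℤ} {a : E} (ha : V a = w ^ m • a) (n : ℤ) :
    Tendsto (fun M => ergodicMean V (w ^ (-n)) M a) atTop (𝓝 ((Pi.single m a : ℤ → E) n)) := by
  have hw0 : w ≠ 0 := by
    rintro rfl
    simp at hw
  by_cases hn : n = m
  · subst hn
    rw [Pi.single_eq_same]
    refine tendsto_ergodicMean_of_mul_eq_one ha ?_
    rw [← zpow_add₀ hw0, neg_add_cancel, zpow_zero]
  · rw [Pi.single_eq_of_ne hn]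
    refine tendsto_ergodicMean_of_mul_ne_one ha ?_ ?_
    · rw [← zpow_add₀ hw0, norm_zpow_eq_one hw]
    · rw [← zpow_add₀ hw0]
      intro h
      have := hw' _ h
      omega

/-- The ergodic means of a vector in the closed span of the eigenspaces `W n` converge to its
spectral components. -/
theorem exists_tendsto_ergodicMean [CompleteSpace E] (hV : ∀ a, ‖V a‖ ≤ ‖a‖) (hw : ‖w‖ = 1)
    (hw' : ∀ n : ℤ, w ^ n = 1 → n = 0) (hW : ∀ n, ∀ a ∈ W n, V a = w ^ n • a)
    (hWc : ∀ n, IsClosed (W n : Set E)) {a : E} (ha : a ∈ (⨆ n, W n).topologicalClosure) (n : ℤ) :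
    ∃ b ∈ W n, Tendsto (fun M => ergodicMean V (w ^ (-n)) M a) atTop (𝓝 b) := by
  have hle : (⨆ n, W n).topologicalClosure ≤
      convergenceSubmodule (fun M => ergodicMean V (w ^ (-n)) M) (W n) := by
    refine Submodule.topologicalClosure_minimal _ (iSup_le fun m b hb => ?_)
      (isClosed_convergenceSubmodule
        (norm_ergodicMean_apply_le hV (norm_zpow_eq_one hw (-n))) (hWc n))
    refine ⟨_, ?_, tendsto_ergodicMean_single hw hw' (hW m b hb) n⟩
    by_cases hn : n = m
    · subst hn
      rwa [Pi.single_eq_same]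
    · rw [Pi.single_eq_of_ne hn]
      exact zero_mem _
  exact hle ha

/-- The Fejér sums of the spectral components of a vector in the closed span of the eigenspaces
`W n` converge to the vector. -/
theorem tendsto_fejerSum_of_mem_closure (hV : ∀ a, ‖V a‖ ≤ ‖a‖) (hw : ‖w‖ = 1)
    (hw' : ∀ n : ℤ, w ^ n = 1 → n = 0) (hW : ∀ n, ∀ a ∈ W n, V a = w ^ n • a)
    {a : E} (ha : a ∈ (⨆ n, W n).topologicalClosure)
    {p : ℤ → E} (hp : ∀ n, Tendsto (fun M => ergodicMean V (w ^ (-n)) M a) atTop (𝓝 (p n))) :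
    Tendsto (fejerSum p) atTop (𝓝 a) := by
  -- `D` holds the vectors recovered by their own Fejér sums. It contains the algebraic sum of the
  -- eigenspaces; the closure is reached by the uniform bound `h3`.
  let D : Submodule ℂ E :=
    { carrier := {b | ∃ q : ℤ → E,
        (∀ n, Tendsto (fun M => ergodicMean V (w ^ (-n)) M b) atTop (𝓝 (q n))) ∧
          Tendsto (fejerSum q) atTop (𝓝 b)}
      add_mem' := by
        rintro b b' ⟨q, h1, h2⟩ ⟨q', h1', h2'⟩
        exact ⟨q + q', fun n => by simpa using (h1 n).add (h1' n),
          (h2.add h2').congr fun N => (fejerSum_add q q' N).symm⟩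
      zero_mem' := ⟨0, fun n => by simp, tendsto_const_nhds.congr fun N => by simp [fejerSum]⟩
      smul_mem' := by
        rintro c b ⟨q, h1, h2⟩
        exact ⟨c • q, fun n => by simpa using (h1 n).const_smul c,
          (h2.const_smul c).congr fun N => (fejerSum_smul c q N).symm⟩ }
  have hD : ⨆ n, W n ≤ D := iSup_le fun m b hb =>
    ⟨_, tendsto_ergodicMean_single hw hw' (hW m b hb), tendsto_fejerSum_single m b⟩
  rw [Metric.tendsto_atTop]
  intro ε hε
  obtain ⟨b, hb, hab⟩ := Metric.mem_closure_iff.mp ha (ε / 3) (by positivity)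
  obtain ⟨q, h1, h2⟩ := hD hb
  obtain ⟨N₀, hN₀⟩ := Metric.tendsto_atTop.mp h2 (ε / 3) (by positivity)
  refine ⟨N₀, fun N hN => ?_⟩
  have h3 : dist (fejerSum p N) (fejerSum q N) ≤ dist a b := by
    rw [dist_eq_norm, dist_eq_norm, ← fejerSum_sub]
    exact norm_fejerSum_le (V := V) (p := p - q) hV hw hw'
      (fun n => by simpa using (hp n).sub (h1 n)) N
  have h4 := dist_triangle4 (fejerSum p N) (fejerSum q N) b a
  rw [dist_comm b a] at h4
  linarith [hN₀ N hN]

/-- Each component of `a` is a limit of linear combinations of the `(V ^ j) a`, so it stays in the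
closed invariant subspace `A`. -/
theorem mem_closure_iSup_inf [CompleteSpace E] (hV : ∀ a, ‖V a‖ ≤ ‖a‖) (hw : ‖w‖ = 1)
    (hw' : ∀ n : ℤ, w ^ n = 1 → n = 0) (hW : ∀ n, ∀ a ∈ W n, V a = w ^ n • a)
    (hWc : ∀ n, IsClosed (W n : Set E)) {A : Submodule ℂ E} (hA : IsClosed (A : Set E))
    (hVA : ∀ a ∈ A, V a ∈ A) {a : E} (ha : a ∈ (⨆ n, W n).topologicalClosure) (haA : a ∈ A) :
    a ∈ (⨆ n, W n ⊓ A).topologicalClosure := by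
  choose p hpW hp using exists_tendsto_ergodicMean hV hw hw' hW hWc ha
  have hpow : ∀ j : ℕ, (V ^ j) a ∈ A := fun j => by
    induction j with
    | zero => simpa
    | succ j ih =>
      rw [pow_succ']
      exact hVA _ ih
  have hpA : ∀ n, p n ∈ A := fun n => by
    refine hA.mem_of_tendsto (hp n) (Eventually.of_forall fun M => ?_)
    rw [ergodicMean_apply]
    exact A.smul_mem _ (sum_mem fun j _ => A.smul_mem _ (hpow j))
  refine mem_closure_of_tendsto (tendsto_fejerSum_of_mem_closure hV hw hw' hW ha hp)
    (Eventually.of_forall fun N => fejerSum_mem (fun n => ?_) N)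
  exact Submodule.mem_iSup_of_mem n ⟨hpW n, hpA n⟩

/-- The ergodic means at frequency `n` converge both to `a` itself and to an element of `W n`. -/
theorem mem_of_mem_closure_of_eigenvector [CompleteSpace E] (hV : ∀ a, ‖V a‖ ≤ ‖a‖) (hw : ‖w‖ = 1)
    (hw' : ∀ n : ℤ, w ^ n = 1 → n = 0) (hW : ∀ n, ∀ a ∈ W n, V a = w ^ n • a)
    (hWc : ∀ n, IsClosed (W n : Set E)) {a : E} (ha : a ∈ (⨆ n, W n).topologicalClosure)
    {n : ℤ} (han : V a = w ^ n • a) : a ∈ W n := by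
  obtain ⟨b, hb, h⟩ := exists_tendsto_ergodicMean hV hw hw' hW hWc ha n
  have h' := tendsto_ergodicMean_single hw hw' han n
  rw [Pi.single_eq_same] at h'
  rwa [tendsto_nhds_unique h' h]

end Spectral

end ErgodicMeans

/-! ### Commutation relations and conjugation by `λ₁`. -/

section Operators

variable (α : ℝ)

theorem mulOp_mul (f g : C(X, ℂ)) : mulOp α (f * g) = mulOp α f * mulOp α g := by
  ext1 ξ
  refine Lp.ext ?_
  filter_upwards [mulOp_ae α (f * g) ξ, mulOp_ae α f (mulOp α g ξ), mulOp_ae α g ξ]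
    with p h1 h2 h3
  rw [mul_apply_eq_comp, h1, h2, h3]
  simp only [orbitFun, ContinuousMap.mul_apply, mul_assoc]

theorem norm_mulOp_apply_le (f : C(X, ℂ)) (ξ : H) : ‖mulOp α f ξ‖ ≤ ‖f‖ * ‖ξ‖ := by
  refine Lp.norm_le_mul_norm_of_ae_le_mul ?_
  filter_upwards [mulOp_ae α f ξ] with p hp
  rw [hp, norm_mul]
  gcongr
  exact f.norm_coe_le_norm _

/-- The representation of `C(X)` as a continuous linear map. -/
noncomputable def mulOpL : C(X, ℂ) →L[ℂ] B :=
  LinearMap.mkContinuous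
    { toFun := mulOp α
      map_add' := fun f g => by
        ext1 ξ
        refine Lp.ext ?_
        filter_upwards [mulOp_ae α (f + g) ξ, mulOp_ae α f ξ, mulOp_ae α g ξ,
          Lp.coeFn_add (mulOp α f ξ) (mulOp α g ξ)] with p h1 h2 h3 h4
        rw [_root_.add_apply, h4, Pi.add_apply, h1, h2, h3]
        simp only [orbitFun, ContinuousMap.add_apply, add_mul]
      map_smul' := fun c f => by
        ext1 ξ
        refine Lp.ext ?_
        filter_upwards [mulOp_ae α (c • f) ξ, mulOp_ae α f ξ,
          Lp.coeFn_smul c (mulOp α f ξ)] with p h1 h2 h3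
        rw [RingHom.id_apply, _root_.smul_apply, h3, Pi.smul_apply, h1, h2]
        simp only [orbitFun, ContinuousMap.smul_apply, smul_eq_mul, mul_assoc] }
    1 fun f => by
      rw [one_mul]
      exact ContinuousLinearMap.opNorm_le_bound _ (norm_nonneg f) (norm_mulOp_apply_le α f)

theorem expOp_add (m n : ℤ) : expOp α (m + n) = expOp α m * expOp α n := by
  rw [expOp, expOp, expOp, ← mulOp_mul]
  congr 1
  ext x
  simp

/-- Both `e^{inx}` and its inverse `e^{-inx}` are contractions. -/
theorem norm_expOp_apply (n : ℤ) (ξ : H) : ‖expOp α n ξ‖ = ‖ξ‖ := by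
  have h : ∀ (n : ℤ) (ξ : H), ‖expOp α n ξ‖ ≤ ‖ξ‖ := fun n ξ => by
    have := norm_mulOp_apply_le α (fourier n) ξ
    rwa [fourier_norm, one_mul] at this
  refine le_antisymm (h n ξ) ?_
  have h1 : expOp α (-n) (expOp α n ξ) = ξ := by
    rw [← mul_apply_eq_comp, ← expOp_add, neg_add_cancel, expOp_zero]
    rfl
  conv_lhs => rw [← h1]
  exact h _ _

theorem star_expOp (n : ℤ) : star (expOp α n) = expOp α (-n) := by
  have h : star (expOp α n) * expOp α n = 1 :=
    (expOp α n).norm_map_iff_adjoint_comp_self.mp (norm_expOp_apply α n)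
  calc star (expOp α n) = star (expOp α n) * (expOp α n * expOp α (-n)) := by
        rw [← expOp_add, add_neg_cancel, expOp_zero, mul_one]
    _ = expOp α (-n) := by rw [← mul_assoc, h, one_mul]

theorem expOp_neg_mul_expOp (n : ℤ) : expOp α (-n) * expOp α n = 1 := by
  rw [← expOp_add, neg_add_cancel, expOp_zero]

theorem expOp_mul_expOp_neg (n : ℤ) : expOp α n * expOp α (-n) = 1 := by
  rw [← expOp_add, add_neg_cancel, expOp_zero]

/-- `λ₁ e^{inx} = e^{inα} e^{inx} λ₁`. -/
theorem lam_mul_expOp (n : ℤ) :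
    lam 1 * expOp α n = ((Circle.exp α : ℂ) ^ n) • (expOp α n * lam 1) := by
  ext1 ξ
  refine Lp.ext ?_
  have h := (measurePreserving_shift 1).quasiMeasurePreserving.ae (mulOp_ae α (fourier n) ξ)
  filter_upwards [lam_ae 1 (expOp α n ξ), h, mulOp_ae α (fourier n) (lam 1 ξ), lam_ae 1 ξ,
    Lp.coeFn_smul ((Circle.exp α : ℂ) ^ n) (expOp α n (lam 1 ξ))] with p h1 h2 h3 h4 h5
  rw [_root_.smul_apply, mul_apply_eq_comp, mul_apply_eq_comp, h1, h5,
    Pi.smul_apply]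
  change mulOp α (fourier n) ξ (p.1 - 1, p.2) = _ • mulOp α (fourier n) (lam 1 ξ) p
  rw [h2, h3, h4, smul_eq_mul, ← mul_assoc]
  congr 1
  have h6 : p.2 - (p.1 - 1) • (α : X) = (α : X) + (p.2 - p.1 • (α : X)) := by
    rw [sub_smul, one_smul]
    abel
  have h7 : fourier n (α : X) = (Circle.exp α : ℂ) ^ n := by
    rw [fourier_coe_apply, Circle.coe_exp, ← Complex.exp_int_mul]
    congr 1
    have : (Real.pi : ℂ) ≠ 0 := by exact_mod_cast Real.pi_ne_zero
    push_cast
    field_simp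
  simp only [orbitFun]
  rw [h6, ← h7, fourier_apply, fourier_apply, fourier_apply, smul_add, AddCircle.toCircle_add,
    Circle.coe_mul]

/-- The one point where irrationality enters: it separates the eigenvalues of the conjugation. -/
theorem circle_exp_zpow_eq_one {α : ℝ} (hα : Irrational (α / (2 * Real.pi))) (n : ℤ)
    (h : (Circle.exp α : ℂ) ^ n = 1) : n = 0 := by
  rw [Circle.coe_exp, ← Complex.exp_int_mul, Complex.exp_eq_one_iff] at h
  obtain ⟨k, hk⟩ := h
  by_contra hn
  refine hα ⟨(k : ℚ) / n, ?_⟩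
  have h1 : (n : ℝ) * α = k * (2 * Real.pi) := by
    have h2 : ((n : ℂ) * α) * Complex.I = (k * (2 * Real.pi)) * Complex.I := by
      rw [mul_assoc, hk]
      ring
    exact_mod_cast mul_right_cancel₀ Complex.I_ne_zero h2
  have hn' : (n : ℝ) ≠ 0 := by exact_mod_cast hn
  push_cast
  field_simp
  linarith

/-- Conjugation by `λ₁`. -/
noncomputable def conjLam : B →L[ℂ] B :=
  (ContinuousLinearMap.mul ℂ B (lam 1)).comp
    ((ContinuousLinearMap.mul ℂ B).flip (star (lam 1)))

theorem conjLam_apply (a : B) : conjLam a = lam 1 * a * star (lam 1) := by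
  simp [conjLam, mul_assoc]

theorem norm_conjLam_apply_le (a : B) : ‖conjLam a‖ ≤ ‖a‖ := by
  rw [conjLam_apply, CStarRing.norm_mul_mem_unitary _ (Unitary.star_mem (lam_mem_unitary 1)),
    CStarRing.norm_mem_unitary_mul _ (lam_mem_unitary 1)]

theorem conjLam_expOp_mul (n : ℤ) (η : cstarZ) :
    conjLam (expOp α n * (η : B)) = ((Circle.exp α : ℂ) ^ n) • (expOp α n * (η : B)) := by
  have hc : (η : B) * lam 1 = lam 1 * η := by
    have := mul_comm η (⟨lam 1, StarAlgebra.elemental.self_mem ℂ _⟩ : cstarZ)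
    exact congrArg Subtype.val this
  rw [conjLam_apply, ← mul_assoc, lam_mul_expOp, smul_mul_assoc, smul_mul_assoc, mul_assoc,
    mul_assoc, ← mul_assoc (lam 1), ← hc, mul_assoc (η : B),
    (Unitary.mem_iff.mp (lam_mem_unitary 1)).2, mul_one]

theorem conjLam_mem {A : StarSubalgebra ℂ B} (hA : cstarZ ≤ A) {a : B} (ha : a ∈ A) :
    conjLam a ∈ A := by
  have h := hA (StarAlgebra.elemental.self_mem ℂ (lam 1))
  rw [conjLam_apply]
  exact mul_mem (mul_mem h ha) (star_mem h)

end Operators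

/-! ### Functions on the circle as elements of `C*_r(ℤ)`. -/

section Hat

/-- Tietze extension from the spectrum to the circle. The argument does not need the spectrum to be
the whole circle. -/
theorem hat_surjective : Function.Surjective hat := by
  intro η
  obtain ⟨g, rfl⟩ := (continuousFunctionalCalculus (lam 1)).surjective η
  have he : Topology.IsClosedEmbedding spectrumToCircle := by
    refine spectrumToCircle.continuous.isClosedEmbedding fun x y h => ?_
    exact Subtype.ext (congrArg (fun z : Circle => (z : ℂ)) h)
  obtain ⟨f, hf⟩ := g.exists_extension he
  exact ⟨f, congrArg (continuousFunctionalCalculus (lam 1)) hf⟩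

/-- The identification `C(S¹) → C*_r(ℤ)`, with values in the bounded operators. -/
noncomputable def hatOp : C(Circle, ℂ) →⋆ₐ[ℂ] B := cstarZ.subtype.comp hat

theorem hatOp_apply (φ : C(Circle, ℂ)) : hatOp φ = (hat φ : B) := rfl

theorem continuous_starAlgHom_circle (F : C(Circle, ℂ) →⋆ₐ[ℂ] B) : Continuous F :=
  AddMonoidHomClass.continuous_of_bound F 1 fun φ => by
    rw [one_mul]
    exact NonUnitalStarAlgHom.norm_apply_le F φ

theorem continuous_hat : Continuous hat :=
  Continuous.subtype_mk (continuous_starAlgHom_circle hatOp) fun φ => (hat φ).2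

/-- The coordinate function of the circle. -/
def circleCoord : C(Circle, ℂ) := ⟨fun z => z, continuous_subtype_val⟩

theorem hatOp_circleCoord : hatOp circleCoord = lam 1 :=
  congrArg Subtype.val (continuousFunctionalCalculus_map_id (lam 1))

/-- By Stone–Weierstrass the coordinate function generates a dense *-subalgebra. -/
theorem starAlgHom_circle_ext {F G : C(Circle, ℂ) →⋆ₐ[ℂ] B}
    (h : F circleCoord = G circleCoord) : F = G := by
  have htop : (StarAlgebra.adjoin ℂ {circleCoord}).topologicalClosure = ⊤ := by
    refine ContinuousMap.starSubalgebra_topologicalClosure_eq_top_of_separatesPoints _ ?_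
    intro x y hxy
    exact ⟨_, ⟨circleCoord, StarAlgebra.self_mem_adjoin_singleton ℂ _, rfl⟩,
      fun h => hxy (Subtype.ext h)⟩
  have hcl : IsClosed (StarAlgHom.equalizer F G : Set C(Circle, ℂ)) :=
    isClosed_eq (continuous_starAlgHom_circle F) (continuous_starAlgHom_circle G)
  have hle := StarSubalgebra.topologicalClosure_minimal
    (StarAlgHom.adjoin_le_equalizer F G (s := {circleCoord}) (by simpa using h)) hcl
  rw [htop] at hle
  exact StarAlgHom.ext fun φ => hle (StarSubalgebra.mem_top (x := φ))

variable (α : ℝ)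

theorem expOp_mem_unitary (n : ℤ) : expOp α n ∈ unitary B :=
  Unitary.mem_iff.mpr ⟨by rw [star_expOp, expOp_neg_mul_expOp],
    by rw [star_expOp, expOp_mul_expOp_neg]⟩

theorem tau_zpow_apply (n : ℤ) (z : Circle) : (tau α ^ n) z = Circle.exp α ^ n * z := by
  have h1 : ∀ z, tau α z = Circle.exp α * z := fun _ => rfl
  have h2 : ∀ z, (tau α)⁻¹ z = (Circle.exp α)⁻¹ * z := fun _ => rfl
  induction n generalizing z with
  | zero => simp
  | succ n ih => rw [zpow_add_one, Homeomorph.mul_apply, ih, h1, zpow_add_one, mul_assoc]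
  | pred n ih => rw [zpow_sub_one, Homeomorph.mul_apply, ih, h2, zpow_sub_one, mul_assoc]

/-- `e^{-inx} φ̂ e^{inx}` is the image of `φ ∘ τⁿ`. -/
theorem hatOp_comp_tau_zpow (n : ℤ) (φ : C(Circle, ℂ)) :
    hatOp (φ.comp ((tau α ^ n : Circle ≃ₜ Circle) : C(Circle, Circle))) =
      expOp α (-n) * hatOp φ * expOp α n := by
  have h : hatOp.comp (((tau α ^ n : Circle ≃ₜ Circle) : C(Circle, Circle)).compStarAlgHom' ℂ ℂ) =
      (Unitary.conjStarAlgAut ℂ B ⟨expOp α (-n), expOp_mem_unitary α (-n)⟩ : B →⋆ₐ[ℂ] B).comp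
        hatOp := by
    refine starAlgHom_circle_ext ?_
    have h1 : circleCoord.comp ((tau α ^ n : Circle ≃ₜ Circle) : C(Circle, Circle)) =
        ((Circle.exp α : ℂ) ^ n) • circleCoord := by
      ext z
      change (((tau α ^ n) z : Circle) : ℂ) = (Circle.exp α : ℂ) ^ n * (z : ℂ)
      rw [tau_zpow_apply, Circle.coe_mul, Circle.coe_zpow]
    change hatOp (circleCoord.comp _) = expOp α (-n) * hatOp circleCoord * star (expOp α (-n))
    rw [h1, map_smul, hatOp_circleCoord, star_expOp, neg_neg, mul_assoc, lam_mul_expOp,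
      mul_smul_comm, ← mul_assoc, expOp_neg_mul_expOp, one_mul]
  have h2 := DFunLike.congr_fun h φ
  change hatOp _ = expOp α (-n) * hatOp φ * star (expOp α (-n)) at h2
  rwa [star_expOp, neg_neg] at h2

theorem hatOp_mul_expOp (n : ℤ) (φ : C(Circle, ℂ)) :
    hatOp φ * expOp α n =
      expOp α n * hatOp (φ.comp ((tau α ^ n : Circle ≃ₜ Circle) : C(Circle, Circle))) := by
  rw [hatOp_comp_tau_zpow, ← mul_assoc, ← mul_assoc, expOp_mul_expOp_neg, one_mul]

theorem star_expOp_mul_hatOp (n : ℤ) (φ : C(Circle, ℂ)) :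
    star (expOp α n * hatOp φ) = expOp α (-n) *
      hatOp ((star φ).comp ((tau α ^ (-n) : Circle ≃ₜ Circle) : C(Circle, Circle))) := by
  rw [star_mul, star_expOp, ← map_star, hatOp_mul_expOp]

theorem expOp_mul_hatOp_mul (m n : ℤ) (φ ψ : C(Circle, ℂ)) :
    expOp α m * hatOp φ * (expOp α n * hatOp ψ) = expOp α (m + n) *
      hatOp (φ.comp ((tau α ^ n : Circle ≃ₜ Circle) : C(Circle, Circle)) * ψ) := by
  rw [mul_assoc, ← mul_assoc (hatOp φ), hatOp_mul_expOp, expOp_add, map_mul, mul_assoc, mul_assoc]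

end Hat

/-! ### Closed ideals, zero sets and the subspaces `e^{inx} I`. -/

section Ideals

/-- A closed ideal consists of the functions that vanish on its zero set. -/
theorem hat_mem_iff (I : ClosedIdeal) (φ : C(Circle, ℂ)) :
    hat φ ∈ I ↔ ∀ z ∈ zeroSet I, φ z = 0 := by
  refine ⟨fun h z hz => hz φ h, fun h => ?_⟩
  -- Pulled back to `C(S¹)`, the ideal is closed, hence determined by its common zeros.
  let J : Ideal C(Circle, ℂ) :=
    { carrier := {ψ | hat ψ ∈ I}
      add_mem' := fun {ψ ψ'} hψ hψ' => by
        change hat (ψ + ψ') ∈ I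
        have h : hat (ψ + ψ') = hat ψ + hat ψ' := hat.map_add' ψ ψ'
        rw [h]
        exact add_mem hψ hψ'
      zero_mem' := by
        change hat 0 ∈ I
        rw [map_zero]
        exact zero_mem I
      smul_mem' := fun ψ ψ' hψ' => by
        change hat (ψ * ψ') ∈ I
        rw [map_mul]
        exact I.toSubmodule.smul_mem (hat ψ) hψ' }
  have hJ : IsClosed (J : Set C(Circle, ℂ)) := I.isClosed.preimage continuous_hat
  change φ ∈ J
  rw [← ContinuousMap.idealOfSet_ofIdeal_isClosed hJ, ContinuousMap.mem_idealOfSet]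
  intro z hz
  exact h z fun ψ hψ => ContinuousMap.notMem_setOfIdeal.mp hz hψ

theorem zeroSet_top : zeroSet ⊤ = ∅ := by
  ext z
  refine ⟨fun h => ?_, fun h => h.elim⟩
  have := h 1 ClosedSubmodule.mem_top
  simp at this

variable (α : ℝ)

theorem mem_image_tau_zpow_iff (n : ℤ) (S : Set Circle) (z : Circle) :
    z ∈ (tau α ^ n) '' S ↔ (tau α ^ (-n)) z ∈ S := by
  constructor
  · rintro ⟨y, hy, rfl⟩
    rwa [← Homeomorph.mul_apply, ← zpow_add, neg_add_cancel, zpow_zero, Homeomorph.one_apply]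
  · intro h
    exact ⟨_, h, by
      rw [← Homeomorph.mul_apply, ← zpow_add, add_neg_cancel, zpow_zero, Homeomorph.one_apply]⟩

/-- The subspace `e^{inx} I`. -/
def expSubspace (n : ℤ) (I : ClosedIdeal) : Submodule ℂ B where
  carrier := {a | ∃ η ∈ I, a = expOp α n * (η : B)}
  add_mem' := by
    rintro _ _ ⟨η, hη, rfl⟩ ⟨ζ, hζ, rfl⟩
    exact ⟨η + ζ, add_mem hη hζ, (mul_add _ _ _).symm⟩
  zero_mem' := ⟨0, zero_mem I, (mul_zero _).symm⟩
  smul_mem' := by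
    rintro c _ ⟨η, hη, rfl⟩
    refine ⟨c • η, ?_, (mul_smul_comm c (expOp α n) (η : B)).symm⟩
    rw [Algebra.smul_def]
    exact I.toSubmodule.smul_mem _ hη

variable {α}

theorem expOp_mul_mem_expSubspace {n : ℤ} {I : ClosedIdeal} {η : cstarZ} :
    expOp α n * (η : B) ∈ expSubspace α n I ↔ η ∈ I := by
  refine ⟨?_, fun h => ⟨η, h, rfl⟩⟩
  rintro ⟨ζ, hζ, h⟩
  have h' := congrArg (expOp α (-n) * ·) h
  simp only [← mul_assoc, expOp_neg_mul_expOp, one_mul] at h'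
  rwa [Subtype.ext h']

theorem isClosed_expSubspace (n : ℤ) (I : ClosedIdeal) :
    IsClosed (expSubspace α n I : Set B) := by
  have h1 : IsClosed ((fun η : cstarZ => (η : B)) '' (I : Set cstarZ)) :=
    (StarAlgebra.elemental.isClosedEmbedding_coe ℂ (lam 1)).isClosedMap _ I.isClosed
  have h2 : (expSubspace α n I : Set B) =
      (fun a => expOp α (-n) * a) ⁻¹' ((fun η : cstarZ => (η : B)) '' (I : Set cstarZ)) := by
    ext a
    constructor
    · rintro ⟨η, hη, rfl⟩
      refine ⟨η, hη, ?_⟩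
      change (η : B) = expOp α (-n) * (expOp α n * η)
      rw [← mul_assoc, expOp_neg_mul_expOp, one_mul]
    · rintro ⟨η, hη, h⟩
      refine ⟨η, hη, ?_⟩
      change (η : B) = _ at h
      rw [h, ← mul_assoc, expOp_mul_expOp_neg, one_mul]
  rw [h2]
  exact h1.preimage (continuous_const.mul continuous_id)

theorem conjLam_of_mem_expSubspace {n : ℤ} {I : ClosedIdeal} {a : B}
    (ha : a ∈ expSubspace α n I) : conjLam a = (Circle.exp α : ℂ) ^ n • a := by
  obtain ⟨η, -, rfl⟩ := ha
  exact conjLam_expOp_mul α n η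

theorem expSubspace_le_Phi (c : IdealFunction) (n : ℤ) :
    expSubspace α n (c.1 n) ≤ (Phi α c).1.toSubalgebra.toSubmodule := by
  rintro _ ⟨η, hη, rfl⟩
  exact StarSubalgebra.le_topologicalClosure _ (StarAlgebra.subset_adjoin ℂ _ ⟨n, η, hη, rfl⟩)

/-- Taking adjoints moves the zero set by `τⁿ`, which is what Cif1 allows. -/
theorem IsClosedIdealFunction.star_mem {c : IdealFunction} (hc : IsClosedIdealFunction α c)
    {n : ℤ} {a : B} (ha : a ∈ expSubspace α n (c.1 n)) :
    star a ∈ expSubspace α (-n) (c.1 (-n)) := by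
  obtain ⟨η, hη, rfl⟩ := ha
  obtain ⟨φ, rfl⟩ := hat_surjective η
  rw [← hatOp_apply, star_expOp_mul_hatOp]
  refine expOp_mul_mem_expSubspace.mpr ((hat_mem_iff _ _).mpr fun z hz => ?_)
  rw [hc.cif1, mem_image_tau_zpow_iff] at hz
  have h := (hat_mem_iff _ _).mp hη _ hz
  change star (φ ((tau α ^ (-n)) z)) = 0
  rw [h, star_zero]

/-- Moving `φ̂` past `e^{inx}` gives the function `(φ ∘ τⁿ) ψ`; Cif2, with `m` and `n` exchanged,
makes one factor vanish at each required zero. Off the support the product is `0`. -/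
theorem IsClosedIdealFunction.mul_mem {c : IdealFunction} (hc : IsClosedIdealFunction α c)
    {m n : ℤ} {a b : B} (ha : a ∈ expSubspace α m (c.1 m)) (hb : b ∈ expSubspace α n (c.1 n)) :
    a * b ∈ expSubspace α (m + n) (c.1 (m + n)) := by
  obtain ⟨η, hη, rfl⟩ := ha
  obtain ⟨ζ, hζ, rfl⟩ := hb
  by_cases hm : c.1 m = ⊥
  · rw [hm, ClosedSubmodule.mem_bot] at hη
    simp [hη]
  by_cases hn : c.1 n = ⊥
  · rw [hn, ClosedSubmodule.mem_bot] at hζ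
    simp [hζ]
  obtain ⟨φ, rfl⟩ := hat_surjective η
  obtain ⟨ψ, rfl⟩ := hat_surjective ζ
  rw [← hatOp_apply, ← hatOp_apply, expOp_mul_hatOp_mul]
  refine expOp_mul_mem_expSubspace.mpr ((hat_mem_iff _ _).mpr fun z hz => ?_)
  rw [add_comm] at hz
  change φ ((tau α ^ n) z) * ψ z = 0
  rcases hc.cif2 n hn m hm hz with h | h
  · rw [mem_image_tau_zpow_iff, neg_neg] at h
    rw [(hat_mem_iff _ _).mp hη _ h, zero_mul]
  · rw [(hat_mem_iff _ _).mp hζ _ h, mul_zero]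

/-- The algebraic sum of the spaces `e^{inx} 𝔠(n)` is already a *-algebra, so generating adds only
limits. -/
theorem IsClosedIdealFunction.Phi_le {c : IdealFunction} (hc : IsClosedIdealFunction α c) :
    (Phi α c).1.toSubalgebra.toSubmodule ≤
      (⨆ n, expSubspace α n (c.1 n)).topologicalClosure := by
  have hle : ∀ a ∈ StarAlgebra.adjoin ℂ (generators α c), a ∈ ⨆ n, expSubspace α n (c.1 n) := by
    intro a ha
    induction ha using StarAlgebra.adjoin_induction with
    | mem a ha =>
      obtain ⟨n, η, hη, rfl⟩ := ha
      exact Submodule.mem_iSup_of_mem n ⟨η, hη, rfl⟩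
    | algebraMap r =>
      refine Submodule.mem_iSup_of_mem 0 ⟨algebraMap ℂ cstarZ r, ?_, ?_⟩
      · rw [c.2]
        exact ClosedSubmodule.mem_top
      · rw [expOp_zero, one_mul]
        rfl
    | add a b _ _ ha hb => exact add_mem ha hb
    | mul a b _ _ ha hb =>
      have h := Submodule.mul_mem_mul ha hb
      rw [Submodule.iSup_mul] at h
      simp_rw [Submodule.mul_iSup] at h
      refine iSup_le (fun m => iSup_le fun n => Submodule.mul_le.mpr fun x hx y hy => ?_) h
      exact Submodule.mem_iSup_of_mem _ (hc.mul_mem hx hy)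
    | star a h ha =>
      clear h
      induction ha using Submodule.iSup_induction' with
      | mem n x hx => exact Submodule.mem_iSup_of_mem _ (hc.star_mem hx)
      | zero =>
        rw [star_zero]
        exact zero_mem _
      | add x y _ _ hx hy =>
        rw [star_add]
        exact add_mem hx hy
  exact fun a ha => closure_mono hle ha

variable (α)

theorem isClosedIdealFunction_top : IsClosedIdealFunction α ⟨fun _ => ⊤, rfl⟩ where
  cif1 n := by simp [zeroSet_top]
  cif2 m _ n _ := by simp [zeroSet_top]

/-- Density of trigonometric polynomials in `C(X)`. Combined with `IsClosedIdealFunction.Phi_le`, it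
puts every element of the crossed product in the closed span of the eigenspaces. -/
theorem crossedProduct_le_Phi_top : crossedProduct α ≤ (Phi α ⟨fun _ => ⊤, rfl⟩).1 := by
  set A := Phi α ⟨fun _ => ⊤, rfl⟩
  refine StarSubalgebra.topologicalClosure_minimal (StarAlgebra.adjoin_le ?_) A.2.2.2
  rintro _ (rfl | ⟨f, rfl⟩)
  · exact A.2.1 (StarAlgebra.elemental.self_mem ℂ (lam 1))
  · have hle : (Submodule.span ℂ (Set.range (fourier (T := 2 * Real.pi)))).topologicalClosure ≤
        A.1.toSubalgebra.toSubmodule.comap (mulOpL α : C(X, ℂ) →ₗ[ℂ] B) := by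
      refine Submodule.topologicalClosure_minimal _ (Submodule.span_le.mpr ?_)
        (A.2.2.2.preimage (mulOpL α).continuous)
      rintro _ ⟨n, rfl⟩
      refine expSubspace_le_Phi (α := α) ⟨fun _ => ⊤, rfl⟩ n
        ⟨1, ClosedSubmodule.mem_top, ?_⟩
      exact (mul_one (expOp α n)).symm
    rw [span_fourier_closure_eq_top] at hle
    exact hle (Submodule.mem_top (x := f))

end Ideals

/-! ### The Galois connection and its closed elements. -/

section Galois

variable (α : ℝ)

theorem gc_Phi_Psi : GaloisConnection (Phi α) (Psi α) := by
  intro c A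
  constructor
  · intro h n η hη
    exact h (expSubspace_le_Phi c n ⟨η, hη, rfl⟩)
  · intro h
    refine StarSubalgebra.topologicalClosure_minimal (StarAlgebra.adjoin_le ?_) A.2.2.2
    rintro _ ⟨n, η, hη, rfl⟩
    exact h n hη

theorem isClosedIdealFunction_Psi (A : IntermediateAlgebra α) :
    IsClosedIdealFunction α (Psi α A) where
  cif1 := by
    -- One inclusion suffices: the other is the same statement for `-n`.
    have h : ∀ (n : ℤ) (z : Circle), z ∈ zeroSet ((Psi α A).1 (-n)) →
        (tau α ^ (-n)) z ∈ zeroSet ((Psi α A).1 n) := by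
      intro n z hz φ hφ
      have h1 : star (expOp α n * hatOp φ) ∈ A.1 := star_mem hφ
      rw [star_expOp_mul_hatOp] at h1
      exact star_eq_zero.mp (hz _ h1)
    intro n
    ext z
    rw [mem_image_tau_zpow_iff]
    refine ⟨h n z, fun hz => ?_⟩
    have h2 := h (-n) ((tau α ^ (-n)) z) (by rwa [neg_neg])
    rwa [neg_neg, ← Homeomorph.mul_apply, ← zpow_add, add_neg_cancel, zpow_zero,
      Homeomorph.one_apply] at h2
  cif2 := by
    intro m _ n _ z hz
    rw [Set.mem_union, mem_image_tau_zpow_iff, neg_neg, or_iff_not_imp_right]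
    intro hm φ hφ
    -- Since `z` is not a common zero at `m`, some admissible `ψ` is nonzero there; multiplying by
    -- it transfers vanishing at `m + n` to `φ ∘ τᵐ`.
    have hm' : ∃ ψ : C(Circle, ℂ), expOp α m * hatOp ψ ∈ A.1 ∧ ψ z ≠ 0 := by
      by_contra! hcon
      exact hm hcon
    obtain ⟨ψ, hψ, hψz⟩ := hm'
    rw [add_comm] at hz
    have h1 : expOp α n * hatOp φ * (expOp α m * hatOp ψ) ∈ A.1 := mul_mem hφ hψ
    rw [expOp_mul_hatOp_mul] at h1
    exact (mul_eq_zero.mp (hz _ h1)).resolve_right hψz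

variable {α}

theorem Phi_Psi (hα : Irrational (α / (2 * Real.pi))) (A : IntermediateAlgebra α) : Phi α (Psi α A) = A := by
  refine le_antisymm ((gc_Phi_Psi α).l_u_le A) fun a ha => ?_
  have ha' := (isClosedIdealFunction_top α).Phi_le (crossedProduct_le_Phi_top α (A.2.2.1 ha))
  have h := mem_closure_iSup_inf norm_conjLam_apply_le (Circle.norm_coe (Circle.exp α))
    (circle_exp_zpow_eq_one hα) (fun n b hb => conjLam_of_mem_expSubspace hb)
    (fun n => isClosed_expSubspace n _) (A := A.1.toSubalgebra.toSubmodule) A.2.2.2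
    (fun b hb => conjLam_mem A.2.1 hb) ha' ha
  refine Submodule.topologicalClosure_minimal
    (t := (Phi α (Psi α A)).1.toSubalgebra.toSubmodule) _ (iSup_le fun n => ?_)
    (Phi α (Psi α A)).2.2.2 h
  rintro _ ⟨⟨η, -, rfl⟩, hη⟩
  exact expSubspace_le_Phi (Psi α A) n ⟨η, hη, rfl⟩

theorem Psi_Phi (hα : Irrational (α / (2 * Real.pi))) {c : IdealFunction}
    (hc : IsClosedIdealFunction α c) :
    Psi α (Phi α c) = c := by
  refine le_antisymm (fun n η hη => ?_) ((gc_Phi_Psi α).le_u_l c)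
  refine expOp_mul_mem_expSubspace.mp (mem_of_mem_closure_of_eigenvector norm_conjLam_apply_le
    (Circle.norm_coe (Circle.exp α)) (circle_exp_zpow_eq_one hα)
    (W := fun n => expSubspace α n (c.1 n)) (fun n b hb => conjLam_of_mem_expSubspace hb)
    (fun n => isClosed_expSubspace n _) (hc.Phi_le hη) (conjLam_expOp_mul α n η))

theorem Psi_Phi_eq_iff (hα : Irrational (α / (2 * Real.pi))) (c : IdealFunction) :
    c = Psi α (Phi α c) ↔ IsClosedIdealFunction α c :=
  ⟨fun h => h ▸ isClosedIdealFunction_Psi α _, fun hc => (Psi_Phi hα hc).symm⟩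

/-- A lower adjoint need not preserve meets. Here both arguments are values of `Ψ`, which does
preserve them, and `Φ ∘ Ψ` is the identity. -/
theorem Phi_inf (hα : Irrational (α / (2 * Real.pi))) {c₁ c₂ : IdealFunction}
    (h₁ : IsClosedIdealFunction α c₁) (h₂ : IsClosedIdealFunction α c₂) : Phi α (c₁ ⊓ c₂) = Phi α c₁ ⊓ Phi α c₂ := by
  conv_lhs => rw [← Psi_Phi hα h₁, ← Psi_Phi hα h₂, ← (gc_Phi_Psi α).u_inf]
  exact Phi_Psi hα _

theorem isClosedIdealFunction_inf (hα : Irrational (α / (2 * Real.pi))) {c₁ c₂ : IdealFunction}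
    (h₁ : IsClosedIdealFunction α c₁) (h₂ : IsClosedIdealFunction α c₂) : IsClosedIdealFunction α (c₁ ⊓ c₂) := by
  rw [← Psi_Phi hα h₁, ← Psi_Phi hα h₂, ← (gc_Phi_Psi α).u_inf]
  exact isClosedIdealFunction_Psi α _

/-- `Φ`, as an isomorphism from closed ideal functions to intermediate algebras. -/
noncomputable def PhiOrderIso (hα : Irrational (α / (2 * Real.pi))) :
    ClosedIdealFunction α ≃o IntermediateAlgebra α where
  toFun c := Phi α c.1
  invFun A := ⟨Psi α A, isClosedIdealFunction_Psi α A⟩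
  left_inv c := Subtype.ext (Psi_Phi hα c.2)
  right_inv A := Phi_Psi hα A
  map_rel_iff' {c₁ c₂} := by
    change Phi α c₁.1 ≤ Phi α c₂.1 ↔ c₁.1 ≤ c₂.1
    rw [gc_Phi_Psi α, Psi_Phi hα c₂.2]

end Galois

end RotationAlgebra

theorem theorem1p2 (α : ℝ) (hα : Irrational (α / (2 * Real.pi))) :
    -- the Galois connection
    (∀ (c : RotationAlgebra.IdealFunction) (A : RotationAlgebra.IntermediateAlgebra α),
      RotationAlgebra.Phi α c ≤ A ↔ c ≤ RotationAlgebra.Psi α A) ∧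
    -- it is perfect on the algebra side
    (∀ A : RotationAlgebra.IntermediateAlgebra α,
      A = RotationAlgebra.Phi α (RotationAlgebra.Psi α A)) ∧
    -- the closed elements among the ideal functions
    (∀ c : RotationAlgebra.IdealFunction,
      c = RotationAlgebra.Psi α (RotationAlgebra.Phi α c) ↔
        RotationAlgebra.IsClosedIdealFunction α c) ∧
    -- closed ideal functions form a lattice under the pointwise meet and the closed join,
    -- and `Φ` respects both operations
    (∀ c₁ c₂ : RotationAlgebra.ClosedIdealFunction α,
      ∃ m j : RotationAlgebra.ClosedIdealFunction α,
        m.1 = c₁.1 ⊓ c₂.1 ∧ IsGLB {c₁, c₂} m ∧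
        j.1 = RotationAlgebra.Psi α (RotationAlgebra.Phi α (c₁.1 ⊔ c₂.1)) ∧ IsLUB {c₁, c₂} j ∧
        RotationAlgebra.Phi α m.1 = RotationAlgebra.Phi α c₁.1 ⊓ RotationAlgebra.Phi α c₂.1 ∧
        RotationAlgebra.Phi α j.1 = RotationAlgebra.Phi α c₁.1 ⊔ RotationAlgebra.Phi α c₂.1) ∧
    -- the restriction of `Φ` to them is an order isomorphism with inverse `Ψ`
    (∃ e : RotationAlgebra.ClosedIdealFunction α ≃o RotationAlgebra.IntermediateAlgebra α,
      (∀ c, e c = RotationAlgebra.Phi α c.1) ∧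
      (∀ A, (e.symm A).1 = RotationAlgebra.Psi α A)) := by
  refine ⟨RotationAlgebra.gc_Phi_Psi α, fun A => (RotationAlgebra.Phi_Psi hα A).symm,
    RotationAlgebra.Psi_Phi_eq_iff hα, fun c₁ c₂ => ?_,
    RotationAlgebra.PhiOrderIso hα, fun _ => rfl, fun _ => rfl⟩
  have hgc := RotationAlgebra.gc_Phi_Psi α
  refine ⟨⟨c₁.1 ⊓ c₂.1, RotationAlgebra.isClosedIdealFunction_inf hα c₁.2 c₂.2⟩,
    ⟨_, RotationAlgebra.isClosedIdealFunction_Psi α (RotationAlgebra.Phi α (c₁.1 ⊔ c₂.1))⟩,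
    rfl, ⟨?_, fun d hd => ?_⟩, rfl, ⟨?_, fun d hd => ?_⟩,
    RotationAlgebra.Phi_inf hα c₁.2 c₂.2, ?_⟩
  · rintro _ (rfl | rfl)
    · exact inf_le_left (α := RotationAlgebra.IdealFunction)
    · exact inf_le_right (α := RotationAlgebra.IdealFunction)
  · exact le_inf (α := RotationAlgebra.IdealFunction) (hd (Set.mem_insert _ _))
      (hd (Set.mem_insert_of_mem _ rfl))
  · rintro _ (rfl | rfl)
    · exact (le_sup_left (α := RotationAlgebra.IdealFunction)).trans (hgc.le_u_l _)
    · exact (le_sup_right (α := RotationAlgebra.IdealFunction)).trans (hgc.le_u_l _)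
  · change RotationAlgebra.Psi α (RotationAlgebra.Phi α (c₁.1 ⊔ c₂.1)) ≤ d.1
    -- The upper bound `d` is fixed by the closure operator `Ψ ∘ Φ`, so monotonicity is enough.
    rw [← RotationAlgebra.Psi_Phi hα d.2]
    exact hgc.monotone_u (hgc.monotone_l (sup_le (α := RotationAlgebra.IdealFunction)
      (hd (Set.mem_insert _ _)) (hd (Set.mem_insert_of_mem _ rfl))))
  · exact (RotationAlgebra.Phi_Psi hα _).trans hgc.l_sup
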